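/- Let $A$ be a C*-algebra (unital or not; for instance the C*-algebra underlying a C*-algebraic quantum group) with a faithful state $f$, that is, a positive linear functional $f\colon A\to\mathbb C$ with $\|f\|=1$ such that $f(a^*a)=0$ implies $a=0$. Let $E_1$ and $E_2$ be (right) Hilbert $A$-modules, with $A$-valued inner products $\langle\cdot,\cdot\rangle_{E_i}$ that are $A$-linear in the second entry, complete for the norms $\|x\|_{E_i}=\|\langle x,x\rangle_{E_i}\|^{1/2}$. Let $F\colon E_1\to E_2$ be a surjective $A$-linear map, i.e. $F$ is additive and $F(xa)=F(x)a$ for all $x\in E_1$, $a\in A$. Then the following four properties are equivalent: \begin{enumerate} \item $F$ is a unitary element of the bounded adjointable operators $\mathcal L(E_1,E_2)$: $F$ is bounded and linear and has a bounded linear adjoint $F^*\colon E_2\to E_1$, with $\langle Fx,y\rangle_{E_2}=\langle x,F^*y\rangle_{E_1}$ for all $x\in E_1$, $y\in E_2$, such that $F^*F=1_{E_1}$ and $FF^*=1_{E_2}$; \item $F$ is an isomorphism of Hilbert $A$-modules: $F$ is a $\mathbb C$-linear, $A$-linear bijection and $\langle x,y\rangle_{E_1}=\langle Fx,Fy\rangle_{E_2}$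 for all $x,y\in E_1$; \item $F$ is an isometry with respect to the norms on $E_1$ and $E_2$; \item $f(\langle x,y\rangle_{E_1})=f(\langle Fx,Fy\rangle_{E_2})$ for all $x,y\in E_1$. \end{enumerate} -/

import Mathlib

open scoped ComplexOrder RightActions

/-- An inner product module over a (possibly non-unital) C⋆-algebra `A`: a complex vector space `E`
with a right `A`-module structure (written `x <• a`) and an `A`-valued inner product which is
`A`-linear in the second entry, positive and definite; the norm of `E` is `‖x‖ = ‖⟪x, x⟫‖ ^ (1/2)`.
Mathlib's `CStarModule` uses a left action, with `⟪x, a • y⟫ = a * ⟪x, y⟫`.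
A (right) Hilbert `A`-module is an inner product module that is complete, i.e. `[CompleteSpace E]`. -/
class InnerProductModule (A E : Type*) [NonUnitalCStarAlgebra A] [PartialOrder A]
    [NormedAddCommGroup E] [NormedSpace ℂ E] [SMul Aᵐᵒᵖ E] extends Inner A E where
  add_rsmul (x y : E) (a : A) : (x + y) <• a = x <• a + y <• a
  rsmul_add (x : E) (a b : A) : x <• (a + b) = x <• a + x <• b
  rsmul_mul (x : E) (a b : A) : x <• (a * b) = (x <• a) <• b
  smul_rsmul (z : ℂ) (x : E) (a : A) : (z • x) <• a = z • (x <• a)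
  rsmul_smul (z : ℂ) (x : E) (a : A) : x <• (z • a) = z • (x <• a)
  inner_add_right (x y z : E) : inner x (y + z) = inner x y + inner x z
  inner_smul_right (z : ℂ) (x y : E) : inner x (z • y) = z • inner x y
  inner_rsmul_right (x y : E) (a : A) : inner x (y <• a) = inner x y * a
  star_inner (x y : E) : star (inner x y) = inner y x
  inner_self_nonneg (x : E) : 0 ≤ inner x x
  inner_self_eq_zero (x : E) : inner x x = 0 ↔ x = 0
  norm_eq_sqrt (x : E) : ‖x‖ = √‖inner x x‖

/-- A faithful state on a C⋆-algebra: a positive linear functional of norm one that vanishes on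
no nonzero positive element. -/
structure IsFaithfulState {A : Type*} [NonUnitalCStarAlgebra A] (f : A →L[ℂ] ℂ) : Prop where
  nonneg (a : A) : 0 ≤ f (star a * a)
  norm_eq_one : ‖f‖ = 1
  faithful (a : A) : f (star a * a) = 0 → a = 0

section Maps

variable (A : Type*) {E₁ E₂ : Type*} [NonUnitalCStarAlgebra A] [PartialOrder A]
  [NormedAddCommGroup E₁] [NormedSpace ℂ E₁] [SMul Aᵐᵒᵖ E₁] [InnerProductModule A E₁]
  [NormedAddCommGroup E₂] [NormedSpace ℂ E₂] [SMul Aᵐᵒᵖ E₂] [InnerProductModule A E₂]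

/-- `A`-linear maps of right `A`-modules. -/
structure IsModuleMap (F : E₁ → E₂) : Prop where
  map_add (x y : E₁) : F (x + y) = F x + F y
  map_rsmul (x : E₁) (a : A) : F (x <• a) = F x <• a

/-- `S` is the adjoint of `T`: `⟪T x, y⟫ = ⟪x, S y⟫` for all `x`, `y`. -/
def IsAdjoint (T : E₁ →L[ℂ] E₂) (S : E₂ →L[ℂ] E₁) : Prop :=
  ∀ (x : E₁) (y : E₂), inner A (T x) y = inner A x (S y)

variable (E₁ E₂) in
/-- The bounded adjointable operators `𝓛(E₁, E₂)`. -/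
def adjointableOperators : Set (E₁ →L[ℂ] E₂) :=
  {T | IsModuleMap A T ∧ ∃ S : E₂ →L[ℂ] E₁, IsModuleMap A S ∧ IsAdjoint A T S}

/-- `F` is a unitary element of `𝓛(E₁, E₂)`: it is (the underlying map of) a bounded adjointable
operator `U` whose adjoint `V` satisfies `V U = 1` and `U V = 1`. -/
def IsUnitaryOperator (F : E₁ → E₂) : Prop :=
  ∃ U ∈ adjointableOperators A E₁ E₂, ⇑U = F ∧
    ∃ V : E₂ →L[ℂ] E₁, IsAdjoint A U V ∧
      V.comp U = ContinuousLinearMap.id ℂ E₁ ∧ U.comp V = ContinuousLinearMap.id ℂ E₂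

/-- An isomorphism of Hilbert C⋆-modules: a linear bijection which is `A`-linear and preserves the
`A`-valued inner product. -/
structure IsHilbertModuleIso (F : E₁ → E₂) : Prop where
  linear : IsLinearMap ℂ F
  bijective : Function.Bijective F
  moduleMap : IsModuleMap A F
  inner_map (x y : E₁) : inner A x y = inner A (F x) (F y)

end Maps

/-!
Each of the four properties amounts to `⟪x, y⟫ = ⟪F x, F y⟫`: an inner-product-preserving map is
isometric, hence injective, and the inverse of an inner-product-preserving bijection is its adjoint.
From (4), replacing `y` by `y <• c` gives `f (⟪x, y⟫ * c) = f (⟪F x, F y⟫ * c)` for every `c`, and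
taking `c` to be the adjoint of `⟪x, y⟫ - ⟪F x, F y⟫` lets faithfulness conclude. From (3),
`‖star c * ⟪x, x⟫ * c‖ = ‖x <• c‖ ^ 2` is preserved for every `c`, and these norms determine the
positive element `⟪x, x⟫`: if `‖a * c‖ ≤ ‖b * c‖` for all `c`, put `r = star b * b + ε` and
`c = r⁻¹ * star a` to get `‖a * r ^ (-1/2)‖ ^ 2 ≤ ‖a * r ^ (-1/2)‖`, that is `star a * a ≤ r`.
Polarization then recovers `⟪x, y⟫`.
-/

theorem eq_of_forall_map_mul_eq {R M : Type*} [NonUnitalRing R] [StarRing R] [AddGroup M]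
    {f : R →+ M} (hf : ∀ a, f (star a * a) = 0 → a = 0) {a b : R}
    (h : ∀ c, f (a * c) = f (b * c)) : a = b := by
  have hstar : star (a - b) = 0 := hf _ <| by
    rw [star_star, sub_mul, map_sub, h, sub_self]
  rwa [star_eq_zero, sub_eq_zero] at hstar

section Order

theorem le_of_forall_pos_le_add_smul {M : Type*} [AddCommMonoid M] [Module ℝ M]
    [TopologicalSpace M] [ContinuousAdd M] [ContinuousSMul ℝ M] [Preorder M]
    [ClosedIciTopology M] {x y : M} (e : M) (h : ∀ ε : ℝ, 0 < ε → x ≤ y + ε • e) : x ≤ y := by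
  have hlim : Filter.Tendsto (fun ε : ℝ ↦ y + ε • e) (nhdsWithin 0 (Set.Ioi 0)) (nhds y) := by
    have hcont : Continuous fun ε : ℝ ↦ y + ε • e := by fun_prop
    simpa only [zero_smul, add_zero] using (hcont.tendsto 0).mono_left nhdsWithin_le_nhds
  exact ge_of_tendsto hlim (Filter.eventually_of_mem self_mem_nhdsWithin h)

theorem norm_star_mul_star_mul_self_mul {A : Type*} [NonUnitalNormedRing A] [StarRing A]
    [CStarRing A] (a c : A) : ‖star c * (star a * a) * c‖ = ‖a * c‖ ^ 2 := by
  rw [sq, ← CStarRing.norm_star_mul_self, star_mul]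
  simp only [mul_assoc]

theorem star_mul_self_le_iff_norm_mul_rpow_le_one {B : Type*} [CStarAlgebra B] [PartialOrder B]
    [StarOrderedRing B] (a : B) {r : B} (hr : IsStrictlyPositive r) :
    star a * a ≤ r ↔ ‖a * r ^ (-(1 / 2) : ℝ)‖ ≤ 1 := by
  have ha : 0 ≤ star a * a := star_mul_self_nonneg a
  have hsqrt : star (CFC.sqrt (star a * a)) * CFC.sqrt (star a * a) = star a * a := by
    rw [(CFC.sqrt_nonneg (star a * a)).star_eq, CFC.sqrt_mul_sqrt_self _ ha]
  rw [le_iff_norm_sqrt_mul_rpow _ _ ha hr, ← sq_le_one_iff₀ (norm_nonneg _),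
    ← norm_star_mul_star_mul_self_mul, hsqrt, norm_star_mul_star_mul_self_mul,
    sq_le_one_iff₀ (norm_nonneg _)]

-- Testing on the left ideal generated by `star a` suffices, so that in the unitization of an
-- algebra `A` only elements of `A` have to be tested.
theorem star_mul_self_le_of_norm_mul_mul_star_le {B : Type*} [CStarAlgebra B] [PartialOrder B]
    [StarOrderedRing B] {a b : B} (h : ∀ c, ‖a * (c * star a)‖ ≤ ‖b * (c * star a)‖) :
    star a * a ≤ star b * b := by
  refine le_of_forall_pos_le_add_smul 1 fun ε hε ↦ ?_
  have hε_one : IsStrictlyPositive (ε • (1 : B)) := .smul hε isStrictlyPositive_one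
  have hr : IsStrictlyPositive (star b * b + ε • 1) := .nonneg_add (star_mul_self_nonneg b) hε_one
  have hb := (star_mul_self_le_iff_norm_mul_rpow_le_one b hr).mp
    (le_add_of_nonneg_right hε_one.nonneg)
  rw [star_mul_self_le_iff_norm_mul_rpow_le_one a hr]
  set s : B := (star b * b + ε • 1) ^ (-(1 / 2) : ℝ)
  have hs : star s = s := CFC.rpow_nonneg.star_eq
  have hsq : ‖a * s‖ * ‖a * s‖ ≤ 1 * ‖a * s‖ :=
    calc ‖a * s‖ * ‖a * s‖ = ‖a * (s * s * star a)‖ := by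
          rw [← CStarRing.norm_self_mul_star, star_mul, hs]
          simp only [mul_assoc]
      _ ≤ ‖b * (s * s * star a)‖ := h (s * s)
      _ = ‖(b * s) * star (a * s)‖ := by
          rw [star_mul, hs]
          simp only [mul_assoc]
      _ ≤ ‖b * s‖ * ‖a * s‖ := by
          simpa only [norm_star] using norm_mul_le (b * s) (star (a * s))
      _ ≤ 1 * ‖a * s‖ := by gcongr
  by_contra! hlt
  exact hlt.not_ge (le_of_mul_le_mul_right hsq (one_pos.trans hlt))

variable {A : Type*} [NonUnitalCStarAlgebra A] [PartialOrder A] [StarOrderedRing A]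

open scoped CStarAlgebra in
theorem star_mul_self_le_star_mul_self_of_norm_mul_le {a b : A}
    (h : ∀ c, ‖a * c‖ ≤ ‖b * c‖) : star a * a ≤ star b * b := by
  rw [← Unitization.inr_le_iff _ _ (.star_mul_self a) (.star_mul_self b)]
  simp only [Unitization.inr_mul, Unitization.inr_star]
  refine star_mul_self_le_of_norm_mul_mul_star_le fun c ↦ ?_
  have hfst : (c * star (a : A⁺¹)).fst = 0 := by simp
  lift c * star (a : A⁺¹) to A using hfst with d
  simpa only [← Unitization.inr_mul, Unitization.norm_inr] using h d

theorem le_of_norm_star_mul_mul_le {p q : A} (hp : 0 ≤ p) (hq : 0 ≤ q)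
    (h : ∀ c, ‖star c * p * c‖ ≤ ‖star c * q * c‖) : p ≤ q := by
  obtain ⟨a, rfl⟩ := CStarAlgebra.nonneg_iff_eq_star_mul_self.mp hp
  obtain ⟨b, rfl⟩ := CStarAlgebra.nonneg_iff_eq_star_mul_self.mp hq
  refine star_mul_self_le_star_mul_self_of_norm_mul_le fun c ↦ ?_
  simpa only [norm_star_mul_star_mul_self_mul, sq_le_sq₀, norm_nonneg] using h c

end Order

namespace InnerProductModule

section Basic

variable {A E : Type*} [NonUnitalCStarAlgebra A] [PartialOrder A]
  [NormedAddCommGroup E] [NormedSpace ℂ E] [SMul Aᵐᵒᵖ E] [InnerProductModule A E]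

theorem inner_add_left (x y z : E) : inner A (x + y) z = inner A x z + inner A y z := by
  rw [← star_inner, inner_add_right, star_add, star_inner, star_inner]

theorem inner_sub_right (x y z : E) : inner A x (y - z) = inner A x y - inner A x z := by
  rw [eq_sub_iff_add_eq, ← inner_add_right, sub_add_cancel]

theorem inner_sub_left (x y z : E) : inner A (x - y) z = inner A x z - inner A y z := by
  rw [← star_inner, inner_sub_right, star_sub, star_inner, star_inner]

theorem inner_smul_left (c : ℂ) (x y : E) : inner A (c • x) y = star c • inner A x y := by
  rw [← star_inner, inner_smul_right, star_smul, star_inner]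

theorem inner_rsmul_left (x y : E) (a : A) : inner A (x <• a) y = star a * inner A x y := by
  rw [← star_inner, inner_rsmul_right, star_mul, star_inner]

theorem norm_rsmul_sq (x : E) (a : A) : ‖x <• a‖ ^ 2 = ‖star a * inner A x x * a‖ := by
  rw [norm_eq_sqrt (A := A), Real.sq_sqrt (norm_nonneg _), inner_rsmul_right, inner_rsmul_left]

theorem four_smul_inner_eq (x y : E) :
    (4 : ℂ) • inner A x y =
      inner A (x + y) (x + y) - inner A (x - y) (x - y)
        - Complex.I • inner A (x + Complex.I • y) (x + Complex.I • y)
        + Complex.I • inner A (x - Complex.I • y) (x - Complex.I • y) := by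
  simp only [inner_add_left, inner_add_right, inner_sub_left, inner_sub_right, inner_smul_left,
    inner_smul_right, smul_add, smul_sub, smul_smul, Complex.star_def, Complex.conj_I,
    mul_neg, Complex.I_mul_I]
  module

variable (A) in
theorem ext_inner_left {x y : E} (h : ∀ w : E, inner A w x = inner A w y) : x = y := by
  rw [← sub_eq_zero, ← inner_self_eq_zero (A := A), inner_sub_right, h, sub_self]

theorem eq_of_forall_rsmul_eq {x y : E} (h : ∀ a : A, x <• a = y <• a) : x = y :=
  ext_inner_left A fun w ↦
    eq_of_forall_map_mul_eq (f := AddMonoidHom.id A)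
      (fun a ↦ (CStarRing.star_mul_self_eq_zero_iff a).mp) fun a ↦ by
        rw [← inner_rsmul_right, h, inner_rsmul_right]

end Basic

section Maps

variable {A E₁ E₂ : Type*} [NonUnitalCStarAlgebra A] [PartialOrder A]
  [NormedAddCommGroup E₁] [NormedSpace ℂ E₁] [SMul Aᵐᵒᵖ E₁] [InnerProductModule A E₁]
  [NormedAddCommGroup E₂] [NormedSpace ℂ E₂] [SMul Aᵐᵒᵖ E₂] [InnerProductModule A E₂]

theorem inner_self_le_inner_self_of_norm_rsmul_le [StarOrderedRing A] {x : E₁} {y : E₂}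
    (h : ∀ a : A, ‖x <• a‖ ≤ ‖y <• a‖) : inner A x x ≤ inner A y y :=
  le_of_norm_star_mul_mul_le (inner_self_nonneg x) (inner_self_nonneg y) fun a ↦ by
    rw [← norm_rsmul_sq, ← norm_rsmul_sq]
    gcongr
    exact h a

theorem inner_map_of_inner_map_self {F : E₁ → E₂} (hF : IsLinearMap ℂ F)
    (h : ∀ x, inner A x x = inner A (F x) (F x)) (x y : E₁) :
    inner A x y = inner A (F x) (F y) := by
  apply smul_right_injective A (four_ne_zero (α := ℂ))
  simp only [four_smul_inner_eq, h, hF.map_add, hF.map_sub, hF.map_smul]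

variable (A) in
theorem norm_map_of_inner_map {F : E₁ → E₂} (h : ∀ x y, inner A x y = inner A (F x) (F y))
    (x : E₁) : ‖F x‖ = ‖x‖ := by
  rw [norm_eq_sqrt (A := A) (F x), norm_eq_sqrt (A := A) x, h]

end Maps

end InnerProductModule

open InnerProductModule

section ModuleMaps

variable {A E₁ E₂ : Type*} [NonUnitalCStarAlgebra A] [PartialOrder A]
  [NormedAddCommGroup E₁] [NormedSpace ℂ E₁] [SMul Aᵐᵒᵖ E₁] [InnerProductModule A E₁]
  [NormedAddCommGroup E₂] [NormedSpace ℂ E₂] [SMul Aᵐᵒᵖ E₂] [InnerProductModule A E₂]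
  {F : E₁ → E₂}

-- Complex scalars can be moved onto the acting algebra element: `F (c • x) <• a = F x <• (c • a)`.
theorem IsModuleMap.isLinearMap (hF : IsModuleMap A F) : IsLinearMap ℂ F where
  map_add := hF.map_add
  map_smul c x := eq_of_forall_rsmul_eq (A := A) fun a ↦ by
    rw [← hF.map_rsmul, smul_rsmul, smul_rsmul, ← rsmul_smul, ← rsmul_smul, hF.map_rsmul]

theorem IsModuleMap.inner_map_of_isometry [StarOrderedRing A] (hF : IsModuleMap A F)
    (hiso : Isometry F) (x y : E₁) : inner A x y = inner A (F x) (F y) := by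
  have hnorm : ∀ x, ‖F x‖ = ‖x‖ :=
    (AddMonoidHomClass.isometry_iff_norm (hF.isLinearMap.mk' F)).mp hiso
  have hnorm_rsmul (x : E₁) (a : A) : ‖F x <• a‖ = ‖x <• a‖ := by rw [← hF.map_rsmul, hnorm]
  refine inner_map_of_inner_map_self hF.isLinearMap (fun x ↦ le_antisymm ?_ ?_) x y
  · exact inner_self_le_inner_self_of_norm_rsmul_le fun a ↦ (hnorm_rsmul x a).ge
  · exact inner_self_le_inner_self_of_norm_rsmul_le fun a ↦ (hnorm_rsmul x a).le

theorem IsModuleMap.inner_map_of_map_inner_eq {M : Type*} [AddGroup M] (hF : IsModuleMap A F)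
    {f : A →+ M} (hf : ∀ a, f (star a * a) = 0 → a = 0)
    (h : ∀ x y, f (inner A x y) = f (inner A (F x) (F y))) (x y : E₁) :
    inner A x y = inner A (F x) (F y) :=
  eq_of_forall_map_mul_eq hf fun c ↦
    calc f (inner A x y * c) = f (inner A x (y <• c)) := by rw [inner_rsmul_right]
      _ = f (inner A (F x) (F (y <• c))) := h x (y <• c)
      _ = f (inner A (F x) (F y) * c) := by rw [hF.map_rsmul, inner_rsmul_right]

theorem IsUnitaryOperator.inner_map (hF : IsUnitaryOperator A F) (x y : E₁) :
    inner A x y = inner A (F x) (F y) := by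
  obtain ⟨U, -, rfl, V, hUV, hVU, -⟩ := hF
  rw [hUV, ← ContinuousLinearMap.comp_apply, hVU, ContinuousLinearMap.id_apply]

theorem IsModuleMap.isHilbertModuleIso (hF : IsModuleMap A F) (hsurj : Function.Surjective F)
    (h : ∀ x y, inner A x y = inner A (F x) (F y)) : IsHilbertModuleIso A F where
  linear := hF.isLinearMap
  bijective := ⟨(AddMonoidHomClass.isometry_of_norm (hF.isLinearMap.mk' F)
    (norm_map_of_inner_map A h)).injective, hsurj⟩
  moduleMap := hF
  inner_map := h

/-- The isomorphism of normed spaces underlying an isomorphism of Hilbert C⋆-modules; its inverse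
is the adjoint. -/
noncomputable def IsHilbertModuleIso.linearIsometryEquiv (hF : IsHilbertModuleIso A F) :
    E₁ ≃ₗᵢ[ℂ] E₂ where
  __ := LinearEquiv.ofBijective (hF.linear.mk' F) hF.bijective
  norm_map' := norm_map_of_inner_map A hF.inner_map

theorem IsHilbertModuleIso.coe_linearIsometryEquiv (hF : IsHilbertModuleIso A F) :
    ⇑hF.linearIsometryEquiv = F :=
  rfl

theorem IsHilbertModuleIso.isometry (hF : IsHilbertModuleIso A F) : Isometry F :=
  hF.linearIsometryEquiv.isometry

theorem IsHilbertModuleIso.map_linearIsometryEquiv_symm (hF : IsHilbertModuleIso A F) (y : E₂) :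
    F (hF.linearIsometryEquiv.symm y) = y :=
  hF.linearIsometryEquiv.apply_symm_apply y

theorem IsHilbertModuleIso.isModuleMap_symm (hF : IsHilbertModuleIso A F) :
    IsModuleMap A hF.linearIsometryEquiv.symm where
  map_add := map_add _
  map_rsmul y a := hF.bijective.injective <| by
    simp only [hF.moduleMap.map_rsmul, hF.map_linearIsometryEquiv_symm]

theorem IsHilbertModuleIso.isAdjoint_symm (hF : IsHilbertModuleIso A F) :
    IsAdjoint A (hF.linearIsometryEquiv : E₁ →L[ℂ] E₂)
      (hF.linearIsometryEquiv.symm : E₂ →L[ℂ] E₁) := fun x y ↦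
  calc inner A (F x) y = inner A (F x) (F (hF.linearIsometryEquiv.symm y)) := by
        rw [hF.map_linearIsometryEquiv_symm]
    _ = inner A x (hF.linearIsometryEquiv.symm y) := (hF.inner_map _ _).symm

theorem IsHilbertModuleIso.isUnitaryOperator (hF : IsHilbertModuleIso A F) :
    IsUnitaryOperator A F :=
  ⟨hF.linearIsometryEquiv, ⟨hF.moduleMap, _, hF.isModuleMap_symm, hF.isAdjoint_symm⟩,
    hF.coe_linearIsometryEquiv, _, hF.isAdjoint_symm,
    ContinuousLinearMap.ext hF.linearIsometryEquiv.symm_apply_apply,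
    ContinuousLinearMap.ext hF.linearIsometryEquiv.apply_symm_apply⟩

end ModuleMaps

theorem mainTheorem9_general {A M E₁ E₂ : Type*}
    [NonUnitalCStarAlgebra A] [PartialOrder A] [StarOrderedRing A] [AddGroup M]
    [NormedAddCommGroup E₁] [NormedSpace ℂ E₁] [SMul Aᵐᵒᵖ E₁] [InnerProductModule A E₁]
    [NormedAddCommGroup E₂] [NormedSpace ℂ E₂] [SMul Aᵐᵒᵖ E₂] [InnerProductModule A E₂]
    (f : A →+ M) (hf : ∀ a, f (star a * a) = 0 → a = 0)
    (F : E₁ → E₂) (hF : IsModuleMap A F) (hsurj : Function.Surjective F) :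
    List.TFAE [
      IsUnitaryOperator A F,
      IsHilbertModuleIso A F,
      Isometry F,
      ∀ x y : E₁, f (inner A x y) = f (inner A (F x) (F y))] := by
  tfae_have 1 → 2 := fun hunitary ↦ hF.isHilbertModuleIso hsurj hunitary.inner_map
  tfae_have 2 → 1 := IsHilbertModuleIso.isUnitaryOperator
  tfae_have 2 → 3 := IsHilbertModuleIso.isometry
  tfae_have 3 → 2 := fun hiso ↦ hF.isHilbertModuleIso hsurj (hF.inner_map_of_isometry hiso)
  tfae_have 2 → 4 := fun hiso x y ↦ congrArg f (hiso.inner_map x y)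
  tfae_have 4 → 2 := fun h ↦ hF.isHilbertModuleIso hsurj (hF.inner_map_of_map_inner_eq hf h)
  tfae_finish

theorem mainTheorem9 {A E₁ E₂ : Type*}
    [NonUnitalCStarAlgebra A] [PartialOrder A] [StarOrderedRing A]
    [NormedAddCommGroup E₁] [NormedSpace ℂ E₁] [SMul Aᵐᵒᵖ E₁] [InnerProductModule A E₁]
    [CompleteSpace E₁]
    [NormedAddCommGroup E₂] [NormedSpace ℂ E₂] [SMul Aᵐᵒᵖ E₂] [InnerProductModule A E₂]
    [CompleteSpace E₂]
    (f : A →L[ℂ] ℂ) (hf : IsFaithfulState f)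
    (F : E₁ → E₂) (hF : IsModuleMap A F) (hsurj : Function.Surjective F) :
    List.TFAE [
      IsUnitaryOperator A F,
      IsHilbertModuleIso A F,
      Isometry F,
      ∀ x y : E₁, f (inner A x y) = f (inner A (F x) (F y))] :=
  mainTheorem9_general (f : A →+ ℂ) hf.faithful F hF hsurj
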